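/- Let $\mathbb{U}^*=\{\zeta\in\mathbb{C}:|\zeta|>1\}$. Let $f$ be a meromorphic function in $\mathbb{U}^*$ with an expansion $f(\zeta)=b\zeta+b_0+\frac{b_1}{\zeta}+\frac{b_2}{\zeta^2}+\cdots$ (with $b,b_0,b_1,\ldots\in\mathbb{C}$) in a neighbourhood of $\infty$, and suppose that $f$ is locally univalent in $\mathbb{U}^*$, that is, each point of $\mathbb{U}^*$ has a neighbourhood in which $f$ is injective as a map into the Riemann sphere. Suppose that there is an analytic function $h:\mathbb{U}^*\to\mathbb{C}$ with $\operatorname{Re}h(\zeta)\ge\frac12$ and $h(\zeta)=1+\frac{h_2}{\zeta^2}+\frac{h_3}{\zeta^3}+\cdots$ for $\zeta\in\mathbb{U}^*$, such that $$\left|\frac{1-h(\zeta)}{h(\zeta)}|\zeta|^2-(|\zeta|^2-1)\left[\frac{\zeta h'(\zeta)}{h(\zeta)}+\frac{\zeta f''(\zeta)}{f'(\zeta)}\right]\right|\le 1$$ for all $\zeta\in\mathbb{U}^*$ that are not poles of $f$. Then $f$ is univalent in $\mathbb{U}^*$, that is, injective on $\mathbb{U}^*$ as a map into the Riemann sphere.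 -/

import Mathlib

open scoped Topology

noncomputable section

/-- The exterior of the closed unit disk (a subset of the finite plane). -/
def exteriorDisk : Set ℂ := {ζ : ℂ | 1 < ‖ζ‖}

/-- `ζ` is a pole of the meromorphic function `f`. -/
def IsPoleOf (f : ℂ → ℂ) (ζ : ℂ) : Prop := meromorphicOrderAt f ζ < 0

open Classical in
/-- A meromorphic function (in normal form) regarded as a map into the Riemann sphere: its value at
a pole is `∞`, its value elsewhere is the usual one. -/
def sphereValue (f : ℂ → ℂ) (ζ : ℂ) : OnePoint ℂ :=
  if IsPoleOf f ζ then OnePoint.infty else ((f ζ : ℂ) : OnePoint ℂ)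

/-- The class of functions that are meromorphic in the exterior of the closed unit disk and have an
expansion `b ζ + b₀ + b₁ / ζ + b₂ / ζ ^ 2 + ⋯` at infinity.  Normal form means
that removable singularities have been removed (and poles carry the dummy value `0`, which
`sphereValue` replaces by `∞`). -/
structure InClassSigma (f : ℂ → ℂ) : Prop where
  meromorphic : MeromorphicNFOn f exteriorDisk
  expansion : ∃ (b : ℂ) (c : ℕ → ℂ) (R : ℝ), ∀ ζ : ℂ, R < ‖ζ‖ →
    HasSum (fun n : ℕ => c n / ζ ^ n) (f ζ - b * ζ)

/-- Univalence of a meromorphic function: injectivity as a map into the Riemann sphere. -/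
def UnivalentOn (f : ℂ → ℂ) (U : Set ℂ) : Prop := Set.InjOn (sphereValue f) U

/-- Local univalence: univalence in a neighbourhood of each point of `U`. -/
def LocallyUnivalentOn (f : ℂ → ℂ) (U : Set ℂ) : Prop :=
  ∀ ζ ∈ U, ∃ V ∈ 𝓝[U] ζ, UnivalentOn f V

/-- `h` has the expansion `1 + h₂ / ζ ^ 2 + h₃ / ζ ^ 3 + ⋯` in the exterior of the unit disk. -/
def HasUnitExpansion (h : ℂ → ℂ) : Prop :=
  ∃ c : ℕ → ℂ, c 0 = 1 ∧ c 1 = 0 ∧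
    ∀ ζ ∈ exteriorDisk, HasSum (fun n : ℕ => c n / ζ ^ n) (h ζ)

end

/-! The proof is by extension across a circle. For `r > 1` and `|w| < r`, let `w* = r² / conj w` be
the reflection of `w`, and continue `f` from `|w| ≥ r` inwards by `E(w) = f(w*) + (w - w*) f'(w*)
h(w*)`. On the circle `w = w*`, so the two maps agree. The inequality, combined with the Schwarz
lemma bound `|1 - h| < |h|`, gives `|∂̄E| < |∂E|`, so `E` is a local homeomorphism
(`norm_beltrami_lt`). The glued map on the plane is proper and injective near infinity because `b ≠
0`, hence globally injective (`injective_of_local_injective_of_proper`). Since `r > 1` is arbitrary,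
`f` is injective on the whole exterior.

Two preliminaries come from one remark: a zero or pole of a meromorphic function makes its
logarithmic derivative unbounded, while the inequality bounds `f''/f'` locally. Hence `f` has no
finite poles, `f' ≠ 0`, and, in the coordinate `η = 1/ζ`, `b ≠ 0`.

The glued map need not be differentiable on the circle; `ApproxMulAt` replaces differentiability
there. -/

open Filter Set Metric Bornology ComplexConjugate


/-! ### Local homeomorphisms of the plane and global injectivity -/

/-- Near `w₀`, increments of `F` differ from multiplication by `k` by a relative error of at most
`c`. -/
def ApproxMulAt (F : ℂ → ℂ) (w₀ k : ℂ) (c : ℝ) : Prop :=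
  ∀ᶠ p : ℂ × ℂ in 𝓝 (w₀, w₀), ‖F p.1 - F p.2 - k * (p.1 - p.2)‖ ≤ c * ‖p.1 - p.2‖

lemma ApproxMulAt.congr {F G : ℂ → ℂ} {w₀ k : ℂ} {c : ℝ} (h : ApproxMulAt F w₀ k c)
    (hFG : F =ᶠ[𝓝 w₀] G) : ApproxMulAt G w₀ k c := by
  have h1 : ∀ᶠ p : ℂ × ℂ in 𝓝 (w₀, w₀), F p.1 = G p.1 :=
    (continuous_fst.tendsto (w₀, w₀)).eventually hFG
  have h2 : ∀ᶠ p : ℂ × ℂ in 𝓝 (w₀, w₀), F p.2 = G p.2 :=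
    (continuous_snd.tendsto (w₀, w₀)).eventually hFG
  unfold ApproxMulAt at *
  filter_upwards [h, h1, h2] with p hp hp1 hp2
  rwa [← hp1, ← hp2]

lemma ApproxMulAt.exists_ball {F : ℂ → ℂ} {w₀ k : ℂ} {c : ℝ} (h : ApproxMulAt F w₀ k c) :
    ∃ ε > 0, ∀ a ∈ ball w₀ ε, ∀ b ∈ ball w₀ ε, ‖F a - F b - k * (a - b)‖ ≤ c * ‖a - b‖ := by
  obtain ⟨ε, hε, H⟩ := Metric.eventually_nhds_iff_ball.1 h
  refine ⟨ε, hε, fun a ha b hb => H (a, b) ?_⟩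
  rw [← ball_prod_same]
  exact ⟨ha, hb⟩

lemma ApproxMulAt.exists_injOn {F : ℂ → ℂ} {w₀ k : ℂ} {c : ℝ} (h : ApproxMulAt F w₀ k c)
    (hc : c < ‖k‖) : ∃ ε > 0, InjOn F (ball w₀ ε) := by
  obtain ⟨ε, hε, H⟩ := h.exists_ball
  refine ⟨ε, hε, fun a ha b hb hab => ?_⟩
  have := H a ha b hb
  rw [hab, sub_self, zero_sub, norm_neg, norm_mul] at this
  by_contra hne
  have : 0 < ‖a - b‖ := norm_pos_iff.2 (sub_ne_zero.2 hne)
  nlinarith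

/-- A perturbation of multiplication by `k` with Lipschitz constant below `‖k‖` is still open, by
the inverse function theorem for maps approximated by a linear equivalence. -/
lemma ApproxMulAt.map_nhds {F : ℂ → ℂ} {w₀ k : ℂ} {c : ℝ} (h : ApproxMulAt F w₀ k c)
    (hc : c < ‖k‖) : map F (𝓝 w₀) = 𝓝 (F w₀) := by
  obtain ⟨ε, hε, H⟩ := h.exists_ball
  -- If `k = 0` then `c < 0`, and the bound fails for any two distinct points.
  by_cases hk : k = 0
  · exfalso
    have h1 : (w₀ + (ε / 2 : ℝ)) ∈ ball w₀ ε := by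
      simp [mem_ball, abs_of_pos hε, dist_eq_norm, hε]
    have := H _ h1 w₀ (mem_ball_self hε)
    have h2 := (norm_nonneg _).trans this
    have : 0 < ‖w₀ + (ε / 2 : ℝ) - w₀‖ := by simp [hε.ne']
    rw [hk, norm_zero] at hc
    nlinarith
  let e : ℂ ≃L[ℂ] ℂ := ContinuousLinearEquiv.unitsEquivAut ℂ (Units.mk0 k hk)
  have he : ApproximatesLinearOn F (e : ℂ →L[ℂ] ℂ) (ball w₀ ε) c.toNNReal := by
    intro a ha b hb
    refine (le_trans (le_of_eq ?_) (H a ha b hb)).trans ?_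
    · simp [e, mul_comm]
    · gcongr
      exact Real.le_coe_toNNReal c
  refine he.map_nhds_eq e.toNonlinearRightInverse (ball_mem_nhds _ hε) (Or.inr ?_)
  have h3 : ‖(e.symm : ℂ →L[ℂ] ℂ)‖₊ ≤ ‖k‖₊⁻¹ := by
    refine ContinuousLinearMap.opNNNorm_le_bound _ _ fun x => ?_
    simp [e, mul_comm]
  have h4 : (0 : NNReal) < ‖k‖₊ := by simpa using hk
  have h5 : c.toNNReal < ‖k‖₊ := by
    rw [← NNReal.coe_lt_coe, Real.coe_toNNReal', coe_nnnorm]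
    exact max_lt hc (norm_pos_iff.2 hk)
  refine h5.trans_le ?_
  have h6 : (0 : NNReal) < ‖(e.symm : ℂ →L[ℂ] ℂ)‖₊ := by
    rw [nnnorm_pos]
    intro h0
    have := congrArg (fun L : ℂ →L[ℂ] ℂ => L (e 1)) h0
    simp at this
  change ‖k‖₊ ≤ (‖(e.symm : ℂ →L[ℂ] ℂ)‖₊)⁻¹
  rw [le_inv_comm₀ h4 h6]
  exact h3

/-- A proper local homeomorphism of the plane which is injective near infinity is injective. -/
theorem injective_of_local_injective_of_proper {F : ℂ → ℂ}
    (hmap : ∀ w, map F (𝓝 w) = 𝓝 (F w)) (hinj : ∀ w, ∃ ε > 0, InjOn F (ball w ε))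
    (hprop : Tendsto F (cobounded ℂ) (cobounded ℂ)) {M : ℝ} (hM : InjOn F {w | M < ‖w‖}) :
    Function.Injective F := by
  have hcont : Continuous F := continuous_iff_continuousAt.2 fun w => (hmap w).le
  let S : Set ℂ := {y | ∃ a b, a ≠ b ∧ F a = y ∧ F b = y}
  have hopen : IsOpen S := by
    rw [isOpen_iff_mem_nhds]
    rintro y ⟨a, b, hab, rfl, hb⟩
    obtain ⟨U, V, hU, hV, haU, hbV, hUV⟩ := t2_separation hab
    have h1 : F '' U ∈ 𝓝 (F a) := by
      rw [← hmap a]; exact image_mem_map (hU.mem_nhds haU)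
    have h2 : F '' V ∈ 𝓝 (F a) := by
      rw [← hb, ← hmap b]; exact image_mem_map (hV.mem_nhds hbV)
    filter_upwards [h1, h2]
    rintro _ ⟨u, hu, rfl⟩ ⟨v, hv, hvu⟩
    exact ⟨u, v, fun h => hUV.ne_of_mem hu hv h, rfl, hvu⟩
  -- Properness keeps both families of preimages bounded, so subsequences converge; local
  -- injectivity at a common limit would force the preimages to coincide eventually.
  have hclosed : IsClosed S := by
    refine IsSeqClosed.isClosed fun y y₀ hy hlim => ?_
    choose a b hab ha hb using hy
    have hbdd : IsBounded (range y) := isBounded_range_of_tendsto y hlim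
    have hpre : IsBounded (F ⁻¹' range y) := by
      have := hprop (isBounded_def.1 hbdd)
      rwa [mem_map, preimage_compl, ← isBounded_def] at this
    obtain ⟨a₀, -, φ, hφ, hlima⟩ := tendsto_subseq_of_bounded hpre
      (fun n => show F (a n) ∈ range y from ⟨n, (ha n).symm⟩)
    obtain ⟨b₀, -, ψ, hψ, hlimb⟩ := tendsto_subseq_of_bounded (x := b ∘ φ) hpre
      (fun n => show F (b (φ n)) ∈ range y from ⟨φ n, (hb _).symm⟩)
    have hlima' : Tendsto (fun n => a (φ (ψ n))) atTop (𝓝 a₀) := hlima.comp hψ.tendsto_atTop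
    have hlimb' : Tendsto (fun n => b (φ (ψ n))) atTop (𝓝 b₀) := hlimb
    have hlimy : Tendsto (fun n => y (φ (ψ n))) atTop (𝓝 y₀) :=
      hlim.comp (hφ.tendsto_atTop.comp hψ.tendsto_atTop)
    have hFa : F a₀ = y₀ := by
      refine tendsto_nhds_unique (((hcont.tendsto a₀).comp hlima').congr fun n => ?_) hlimy
      exact ha _
    have hFb : F b₀ = y₀ := by
      refine tendsto_nhds_unique (((hcont.tendsto b₀).comp hlimb').congr fun n => ?_) hlimy
      exact hb _
    refine ⟨a₀, b₀, fun h => ?_, hFa, hFb⟩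
    obtain ⟨ε, hε, hI⟩ := hinj a₀
    obtain ⟨n, hn1, hn2⟩ := ((hlima'.eventually (ball_mem_nhds _ hε)).and
      ((h ▸ hlimb').eventually (ball_mem_nhds a₀ hε))).exists
    exact hab _ (hI hn1 hn2 ((ha _).trans (hb _).symm))
  -- A value outside the bounded image of the disk of radius `M` is attained only where `F` is
  -- injective.
  have hne : S ≠ univ := by
    intro hS
    obtain ⟨C, hC⟩ := ((isCompact_closedBall (0 : ℂ) M).image hcont).isBounded.exists_norm_le
    obtain ⟨y, hy⟩ := NormedSpace.exists_lt_norm ℂ ℂ C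
    obtain ⟨a, b, hab, ha, hb⟩ : y ∈ S := hS ▸ mem_univ y
    have key : ∀ z, F z = y → M < ‖z‖ := by
      intro z hz
      by_contra! hle
      have := hC (F z) ⟨z, by simpa using hle, rfl⟩
      rw [hz] at this
      linarith
    exact hab (hM (key a ha) (key b hb) (ha.trans hb.symm))
  have hempty : S = ∅ := (isClopen_iff.1 ⟨hclosed, hopen⟩).resolve_right hne
  intro a b hab
  by_contra hne'
  have : F b ∈ S := ⟨a, b, hne', hab, rfl⟩
  rw [hempty] at this
  exact this

/-! ### Gluing along a circle and the reflection extension -/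

lemma HasStrictFDerivAt.approxMulAt {F : ℂ → ℂ} {L : ℂ →L[ℝ] ℂ} {w₀ k : ℂ} {c c' : ℝ}
    (h : HasStrictFDerivAt F L w₀) (hL : ∀ z, ‖L z - k * z‖ ≤ c * ‖z‖) (hc : c < c') :
    ApproxMulAt F w₀ k c' := by
  have h1 := h.isLittleO.def (sub_pos.2 hc)
  unfold ApproxMulAt
  filter_upwards [h1] with p hp
  have h2 := hL (p.1 - p.2)
  calc ‖F p.1 - F p.2 - k * (p.1 - p.2)‖
      = ‖(F p.1 - F p.2 - L (p.1 - p.2)) + (L (p.1 - p.2) - k * (p.1 - p.2))‖ := by ring_nf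
    _ ≤ (c' - c) * ‖p.1 - p.2‖ + c * ‖p.1 - p.2‖ := (norm_add_le _ _).trans (add_le_add hp h2)
    _ = c' * ‖p.1 - p.2‖ := by ring

-- A segment joining the two sides meets the circle at some `p`, where `F` and `G` agree. The errors
-- on the two pieces add up to the right bound because the lengths do.
open Classical in
lemma ApproxMulAt.glue {F G : ℂ → ℂ} {w₀ k : ℂ} {c r : ℝ} (hF : ApproxMulAt F w₀ k c)
    (hG : ApproxMulAt G w₀ k c) (hFG : ∀ w, ‖w‖ = r → F w = G w) :
    ApproxMulAt (fun w => if ‖w‖ < r then F w else G w) w₀ k c := by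
  obtain ⟨ε₁, hε₁, H1⟩ := hF.exists_ball
  obtain ⟨ε₂, hε₂, H2⟩ := hG.exists_ball
  set ε := min ε₁ ε₂
  have hF' : ∀ a ∈ ball w₀ ε, ∀ b ∈ ball w₀ ε, ‖F a - F b - k * (a - b)‖ ≤ c * ‖a - b‖ :=
    fun a ha b hb => H1 a (ball_subset_ball (min_le_left _ _) ha) b
      (ball_subset_ball (min_le_left _ _) hb)
  have hG' : ∀ a ∈ ball w₀ ε, ∀ b ∈ ball w₀ ε, ‖G a - G b - k * (a - b)‖ ≤ c * ‖a - b‖ :=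
    fun a ha b hb => H2 a (ball_subset_ball (min_le_right _ _) ha) b
      (ball_subset_ball (min_le_right _ _) hb)
  have cross : ∀ a ∈ ball w₀ ε, ∀ b ∈ ball w₀ ε, ‖a‖ < r → r ≤ ‖b‖ →
      ‖F a - G b - k * (a - b)‖ ≤ c * ‖a - b‖ := by
    intro a ha b hb har hbr
    have hcont : ContinuousOn (fun x : ℂ => ‖x‖) (segment ℝ a b) := continuous_norm.continuousOn
    obtain ⟨p, hp, hpr⟩ := (convex_segment (𝕜 := ℝ) a b).isPreconnected.intermediate_value
      (left_mem_segment ℝ a b) (right_mem_segment ℝ a b) hcont ⟨har.le, hbr⟩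
    have hpb : p ∈ ball w₀ ε := (convex_ball w₀ ε).segment_subset ha hb hp
    have e1 := hF' a ha p hpb
    have e2 := hG' p hpb b hb
    have e3 : ‖a - p‖ + ‖p - b‖ = ‖a - b‖ := by
      simpa [dist_eq_norm] using dist_add_dist_of_mem_segment hp
    calc ‖F a - G b - k * (a - b)‖
        = ‖(F a - F p - k * (a - p)) + (G p - G b - k * (p - b))‖ := by
          rw [hFG p hpr]; ring_nf
      _ ≤ c * ‖a - p‖ + c * ‖p - b‖ := (norm_add_le _ _).trans (add_le_add e1 e2)
      _ = c * ‖a - b‖ := by rw [← e3]; ring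
  unfold ApproxMulAt
  rw [nhds_prod_eq]
  filter_upwards [prod_mem_prod (ball_mem_nhds w₀ (lt_min hε₁ hε₂))
    (ball_mem_nhds w₀ (lt_min hε₁ hε₂))]
  rintro ⟨a, b⟩ ⟨ha, hb⟩
  simp only at ha hb ⊢
  split_ifs with h1 h2 h2
  · exact hF' a ha b hb
  · exact cross a ha b hb h1 (not_lt.1 h2)
  · have := cross b hb a ha h2 (not_lt.1 h1)
    rw [norm_sub_rev a b]
    refine le_trans (le_of_eq ?_) this
    rw [← norm_neg]
    ring_nf
  · exact hG' a ha b hb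

/-- Extension of `f` from the exterior of the disk of radius `r` across the circle by
`w ↦ A (conj w / r ^ 2) + w * B (conj w / r ^ 2)`: if the Beltrami coefficient of the extension
has modulus less than one, then `f` is injective. -/
theorem injOn_of_reflection {f A B : ℂ → ℂ} {r : ℝ} (hr : 0 < r)
    (hf : ∀ w, r ≤ ‖w‖ → AnalyticAt ℂ f w) (hf' : ∀ w, r ≤ ‖w‖ → deriv f w ≠ 0)
    (hA : ∀ η, ‖η‖ ≤ r⁻¹ → AnalyticAt ℂ A η) (hB : ∀ η, ‖η‖ ≤ r⁻¹ → AnalyticAt ℂ B η)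
    (hglue : ∀ w, ‖w‖ = r → A w⁻¹ + w * B w⁻¹ = f w)
    (hlt : ∀ η, ‖η‖ ≤ r⁻¹ → ‖((r : ℂ) ^ 2)⁻¹ * deriv A η + conj η * deriv B η‖ < ‖B η‖)
    (hbd : ∀ w, ‖w‖ = r → ‖deriv f w - B w⁻¹‖ < ‖B w⁻¹‖)
    (hinf : Tendsto f (cobounded ℂ) (cobounded ℂ)) {M : ℝ} (hM : InjOn f {w | M < ‖w‖}) :
    InjOn f {w | r ≤ ‖w‖} := by
  classical
  let σ : ℂ → ℂ := fun w => ((r : ℂ) ^ 2)⁻¹ * conj w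
  let P : ℂ → ℂ := fun w => A (σ w) + w * B (σ w)
  let F : ℂ → ℂ := fun w => if ‖w‖ < r then P w else f w
  have hrC : (r : ℂ) ≠ 0 := by exact_mod_cast hr.ne'
  have hσnorm : ∀ w, ‖w‖ ≤ r → ‖σ w‖ ≤ r⁻¹ := by
    intro w hw
    simp only [σ, norm_mul, norm_inv, norm_pow, Complex.norm_real, Real.norm_eq_abs,
      abs_of_pos hr, RCLike.norm_conj]
    calc (r ^ 2)⁻¹ * ‖w‖ ≤ (r ^ 2)⁻¹ * r := by gcongr
      _ = r⁻¹ := by field_simp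
  have hσ : ∀ w, ‖w‖ = r → σ w = w⁻¹ := by
    intro w hw
    have hw0 : w ≠ 0 := by rintro rfl; simp at hw; exact hr.ne hw
    have : w * conj w = (r : ℂ) ^ 2 := by rw [Complex.mul_conj, Complex.normSq_eq_norm_sq, hw]; simp
    simp only [σ]
    rw [← this]
    have : conj w ≠ 0 := by simpa using hw0
    field_simp
  have hPf : ∀ w, ‖w‖ = r → P w = f w := by
    intro w hw
    simp only [P, hσ w hw, hglue w hw]
  -- Here `∂P = B(σ w)`, and the norm on the left is `|∂̄P|`, since `conj (σ w) = w / r²`.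
  have hP : ∀ w, ‖w‖ ≤ r → ∀ c, ‖((r : ℂ) ^ 2)⁻¹ * deriv A (σ w) + conj (σ w) * deriv B (σ w)‖ < c →
      ApproxMulAt P w (B (σ w)) c := by
    intro w hw c hc
    have hσ' : HasStrictFDerivAt σ (((r : ℂ) ^ 2)⁻¹ • (Complex.conjCLE : ℂ →L[ℝ] ℂ)) w :=
      (Complex.conjCLE : ℂ →L[ℝ] ℂ).hasStrictFDerivAt.const_smul (((r : ℂ) ^ 2)⁻¹)
    have hA' := ((hA _ (hσnorm w hw)).hasStrictDerivAt.hasStrictFDerivAt.restrictScalars ℝ).comp w hσ'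
    have hB' := ((hB _ (hσnorm w hw)).hasStrictDerivAt.hasStrictFDerivAt.restrictScalars ℝ).comp w hσ'
    have hP' := hA'.add ((hasStrictFDerivAt_id (𝕜 := ℝ) w).mul hB')
    refine HasStrictFDerivAt.approxMulAt (F := P) hP' (fun z => ?_) hc
    have hw' : conj (σ w) = ((r : ℂ) ^ 2)⁻¹ * w := by simp [σ]
    rw [hw', ← RCLike.norm_conj z, ← norm_mul]
    refine le_of_eq (congrArg _ ?_)
    simp
    ring
  have hfa : ∀ w, r ≤ ‖w‖ → ∀ k c, ‖deriv f w - k‖ < c → ApproxMulAt f w k c := by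
    intro w hw k c hc
    refine HasStrictFDerivAt.approxMulAt
      ((hf w hw).hasStrictDerivAt.hasStrictFDerivAt.restrictScalars ℝ) (fun z => ?_) hc
    rw [← norm_mul]
    refine le_of_eq (congrArg _ ?_)
    simp
    ring
  have key : ∀ w, ∃ k c, c < ‖k‖ ∧ ApproxMulAt F w k c := by
    intro w
    -- On the circle both pieces are compared with the same multiplier `B w⁻¹`; this is where `hbd`
    -- enters.
    rcases lt_trichotomy ‖w‖ r with h | h | h
    · obtain ⟨c, hc1, hc2⟩ := exists_between (hlt _ (hσnorm w h.le))
      refine ⟨_, c, hc2, (hP w h.le c hc1).congr ?_⟩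
      filter_upwards [continuous_norm.continuousAt.eventually_lt continuousAt_const h] with x hx
      simp [F, hx]
    · have h2 := hbd w h
      rw [← hσ w h] at h2
      obtain ⟨c, hc1, hc2⟩ := exists_between (max_lt (hlt _ (hσnorm w h.le)) h2)
      exact ⟨_, c, hc2, (hP w h.le c ((le_max_left _ _).trans_lt hc1)).glue
        (hfa w h.ge _ c ((le_max_right _ _).trans_lt hc1)) hPf⟩
    · obtain ⟨c, hc1, hc2⟩ := exists_between (norm_pos_iff.2 (hf' w h.le))
      refine ⟨_, c, hc2, (hfa w h.le (deriv f w) c (by simpa using hc1)).congr ?_⟩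
      filter_upwards [continuousAt_const.eventually_lt continuous_norm.continuousAt h] with x hx
      simp [F, hx.le]
  have hFf : ∀ w, r ≤ ‖w‖ → F w = f w := fun w hw => by simp [F, hw]
  have hF : Function.Injective F := by
    refine injective_of_local_injective_of_proper (M := max r M) (fun w => ?_) (fun w => ?_) ?_ ?_
    · obtain ⟨k, c, hc, h⟩ := key w
      exact h.map_nhds hc
    · obtain ⟨k, c, hc, h⟩ := key w
      exact h.exists_injOn hc
    · refine hinf.congr' ?_
      filter_upwards [tendsto_norm_cobounded_atTop.eventually_ge_atTop r] with w hw
      exact (hFf w hw).symm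
    · intro a (ha : max r M < ‖a‖) b (hb : max r M < ‖b‖) hab
      rw [hFf a ((le_max_left _ _).trans_lt ha).le, hFf b ((le_max_left _ _).trans_lt hb).le] at hab
      exact hM ((le_max_right _ _).trans_lt ha) ((le_max_right _ _).trans_lt hb) hab
  intro a ha b hb hab
  exact hF (by rw [hFf a ha, hFf b hb, hab])


/-! ### Absence of poles and critical points -/

lemma isOpen_exteriorDisk : IsOpen exteriorDisk := isOpen_lt continuous_const continuous_norm

/-- At a zero or pole of finite order the logarithmic derivative has a simple pole. -/
lemma meromorphicOrderAt_eq_zero_of_logDeriv_bounded {u : ℂ → ℂ} {p : ℂ} {C : ℝ}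
    (hu : MeromorphicAt u p) (htop : meromorphicOrderAt u p ≠ ⊤)
    (hC : ∀ᶠ z in 𝓝[≠] p, ‖logDeriv u z‖ ≤ C) : meromorphicOrderAt u p = 0 := by
  by_contra h0
  have h1 := meromorphicOrderAt_logDeriv_eq_neg_one hu h0 htop
  have h2 : Tendsto (logDeriv u) (𝓝[≠] p) (cobounded ℂ) :=
    tendsto_cobounded_of_meromorphicOrderAt_neg (by rw [h1]; decide)
  obtain ⟨z, hz1, hz2⟩ :=
    (hC.and ((tendsto_norm_cobounded_atTop.comp h2).eventually_gt_atTop C)).exists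
  exact absurd hz1 (not_le.2 hz2)

lemma AnalyticAt.ne_zero_of_meromorphicOrderAt_eq_zero {u : ℂ → ℂ} {p : ℂ} (hu : AnalyticAt ℂ u p)
    (h : meromorphicOrderAt u p = 0) : u p ≠ 0 :=
  hu.meromorphicNFAt.meromorphicOrderAt_eq_zero_iff.1 h

lemma AnalyticAt.not_isPoleOf {f : ℂ → ℂ} {z : ℂ} (h : AnalyticAt ℂ f z) : ¬ IsPoleOf f z :=
  not_lt.2 h.meromorphicOrderAt_nonneg

/-- A locally univalent function is not locally constant. -/
lemma LocallyUnivalentOn.not_eventually_deriv_eq_zero {f : ℂ → ℂ} {p : ℂ}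
    (hloc : LocallyUnivalentOn f exteriorDisk) (hp : p ∈ exteriorDisk) (hf : AnalyticAt ℂ f p) :
    ¬ ∀ᶠ z in 𝓝[≠] p, deriv f z = 0 := by
  intro h
  obtain ⟨V, hV, hinj⟩ := hloc p hp
  rw [isOpen_exteriorDisk.nhdsWithin_eq hp] at hV
  have h1 : ∀ᶠ z in 𝓝 p, deriv f z = 0 := by
    rcases hf.deriv.eventually_eq_zero_or_eventually_ne_zero with h' | h'
    · exact h'
    · obtain ⟨z, hz1, hz2⟩ := (h.and h').exists
      exact absurd hz1 hz2
  obtain ⟨ε, hε, H⟩ := Metric.eventually_nhds_iff_ball.1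
    ((hf.eventually_analyticAt.and h1).and hV)
  obtain ⟨q, hq, hqp⟩ : ∃ q ∈ ball p ε, q ≠ p :=
    ⟨p + (ε / 2 : ℝ), by simp [mem_ball, dist_eq_norm, abs_of_pos hε, hε], by simp [hε.ne']⟩
  have hconst : f p = f q :=
    (convex_ball p ε).is_const_of_fderivWithin_eq_zero (𝕜 := ℂ)
      (fun x hx => (H x hx).1.1.differentiableAt.differentiableWithinAt)
      (fun x hx => by
        rw [fderivWithin_of_isOpen isOpen_ball hx]
        ext
        simp [(H x hx).1.2]) (mem_ball_self hε) hq
  exact hqp (hinj (H _ (mem_ball_self hε)).2 (H _ hq).2 (by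
    simp [sphereValue, (H _ (mem_ball_self hε)).1.1.not_isPoleOf, (H _ hq).1.1.not_isPoleOf,
      hconst])).symm

lemma ne_zero_of_half_le_re {z : ℂ} (h : 1 / 2 ≤ z.re) : z ≠ 0 := by
  rintro rfl
  norm_num at h

lemma analyticAt_and_deriv_ne_zero {f h : ℂ → ℂ}
    (hf : MeromorphicNFOn f exteriorDisk) (hloc : LocallyUnivalentOn f exteriorDisk)
    (hh : AnalyticOnNhd ℂ h exteriorDisk)
    (hre : ∀ ζ ∈ exteriorDisk, 1 / 2 ≤ (h ζ).re)
    (hineq : ∀ ζ ∈ exteriorDisk, ¬ IsPoleOf f ζ →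
      ‖(1 - h ζ) / h ζ * (‖ζ‖ : ℂ) ^ 2
        - ((‖ζ‖ : ℂ) ^ 2 - 1) *
          (ζ * deriv h ζ / h ζ + ζ * deriv (deriv f) ζ / deriv f ζ)‖ ≤ 1)
    {p : ℂ} (hp : p ∈ exteriorDisk) : AnalyticAt ℂ f p ∧ deriv f p ≠ 0 := by
  have hfp := hf hp
  have hmer := hfp.meromorphicAt
  -- The bound on `|ζ f''/f'|` obtained by solving the inequality for it; it is continuous at `p`,
  -- even if `p` is a pole of `f`.
  let φ : ℂ → ℝ := fun ζ => (1 + ‖(1 - h ζ) / h ζ‖ * ‖ζ‖ ^ 2) / (‖ζ‖ ^ 2 - 1) + ‖ζ * deriv h ζ / h ζ‖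
  have hφ : ContinuousAt φ p := by
    have h1 := (hh p hp).continuousAt
    have h2 := (hh p hp).deriv.continuousAt
    have h3 := ne_zero_of_half_le_re (hre p hp)
    have h4 : ‖p‖ ^ 2 - 1 ≠ 0 := by
      have : 1 < ‖p‖ := hp
      nlinarith
    simp only [φ]
    fun_prop (disch := assumption)
  have hbound : ∀ᶠ ζ in 𝓝[≠] p, ‖logDeriv (deriv f) ζ‖ ≤ φ p + 1 := by
    filter_upwards [hmer.eventually_analyticAt,
      mem_nhdsWithin_of_mem_nhds (isOpen_exteriorDisk.mem_nhds hp),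
      mem_nhdsWithin_of_mem_nhds (hφ.eventually (gt_mem_nhds (lt_add_one (φ p))))] with ζ h1 h2 h3
    have hI := hineq ζ h2 h1.not_isPoleOf
    have hζ : 1 < ‖ζ‖ := h2
    have hs : 0 < ‖ζ‖ ^ 2 - 1 := by nlinarith
    set X := (1 - h ζ) / h ζ
    set Y := ζ * deriv h ζ / h ζ
    have e1 : ‖((‖ζ‖ : ℂ) ^ 2 - 1)‖ = ‖ζ‖ ^ 2 - 1 := by
      rw [← abs_of_pos hs, ← Real.norm_eq_abs, ← Complex.norm_real]
      push_cast
      rfl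
    have e2 : (‖ζ‖ ^ 2 - 1) * ‖Y + ζ * deriv (deriv f) ζ / deriv f ζ‖ ≤ 1 + ‖X‖ * ‖ζ‖ ^ 2 := by
      rw [← e1, ← norm_mul]
      have e3 : ‖X * (‖ζ‖ : ℂ) ^ 2‖ = ‖X‖ * ‖ζ‖ ^ 2 := by simp
      rw [← e3]
      have := norm_sub_norm_le (((‖ζ‖ : ℂ) ^ 2 - 1) * (Y + ζ * deriv (deriv f) ζ / deriv f ζ))
        (X * (‖ζ‖ : ℂ) ^ 2)
      rw [norm_sub_rev] at hI
      linarith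
    have e4 : ‖Y + ζ * deriv (deriv f) ζ / deriv f ζ‖ ≤ (1 + ‖X‖ * ‖ζ‖ ^ 2) / (‖ζ‖ ^ 2 - 1) := by
      rw [le_div_iff₀ hs]
      linarith
    have e5 : ‖ζ * deriv (deriv f) ζ / deriv f ζ‖ ≤ φ ζ := by
      have := norm_sub_le (Y + ζ * deriv (deriv f) ζ / deriv f ζ) Y
      rw [add_sub_cancel_left] at this
      simp only [φ]
      linarith
    have e6 : ‖logDeriv (deriv f) ζ‖ ≤ ‖ζ * deriv (deriv f) ζ / deriv f ζ‖ := by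
      rw [mul_div_assoc, norm_mul, logDeriv_apply]
      nlinarith [norm_nonneg (deriv (deriv f) ζ / deriv f ζ)]
    linarith
  by_cases hpole : meromorphicOrderAt f p < 0
  · exfalso
    obtain ⟨n, hn⟩ := WithTop.ne_top_iff_exists.1 hpole.ne_top
    have hn0 : n < 0 := by rw [← hn] at hpole; exact_mod_cast hpole
    -- At a pole `f'` would have order `n - 1 < 0`, not zero.
    have hd := meromorphicOrderAt_deriv_eq_sub_one (f := f) (x := p) (n := n)
      (by exact_mod_cast hn0.ne) hn.symm
    have := meromorphicOrderAt_eq_zero_of_logDeriv_bounded hmer.deriv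
      (by rw [hd]; exact WithTop.coe_ne_top) hbound
    rw [hd] at this
    have : n - 1 = 0 := by exact_mod_cast this
    omega
  · have ha := hfp.meromorphicOrderAt_nonneg_iff_analyticAt.1 (not_lt.1 hpole)
    refine ⟨ha, ha.deriv.ne_zero_of_meromorphicOrderAt_eq_zero ?_⟩
    refine meromorphicOrderAt_eq_zero_of_logDeriv_bounded hmer.deriv (fun htop => ?_) hbound
    exact hloc.not_eventually_deriv_eq_zero hp ha (meromorphicOrderAt_eq_top_iff.1 htop)

/-! ### The coordinate `η = 1/ζ` at infinity -/

/-- A function with an expansion in powers of `1 / ζ` extends analytically to infinity. -/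
lemma exists_analytic_at_infinity {g : ℂ → ℂ} (hg : AnalyticOnNhd ℂ g exteriorDisk)
    {c : ℕ → ℂ} {R : ℝ} (hsum : ∀ ζ : ℂ, R < ‖ζ‖ → HasSum (fun n : ℕ => c n / ζ ^ n) (g ζ)) :
    ∃ G : ℂ → ℂ, AnalyticOnNhd ℂ G (ball 0 1) ∧ G 0 = c 0 ∧ ∀ ζ ∈ exteriorDisk, g ζ = G ζ⁻¹ := by
  refine ⟨Function.update (fun η => g η⁻¹) 0 (c 0), fun η hη => ?_, by simp, fun ζ hζ => ?_⟩
  · rcases eq_or_ne η 0 with rfl | hne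
    · have : HasFPowerSeriesAt (Function.update (fun η => g η⁻¹) 0 (c 0))
          (FormalMultilinearSeries.ofScalars ℂ c) 0 := by
        rw [hasFPowerSeriesAt_iff]
        have hR : 0 < (|R| + 1)⁻¹ := by positivity
        filter_upwards [ball_mem_nhds (0 : ℂ) hR] with z hz
        rw [zero_add]
        simp only [FormalMultilinearSeries.coeff_ofScalars, smul_eq_mul]
        rcases eq_or_ne z 0 with rfl | hz0
        · rw [Function.update_self]
          convert! hasSum_single (f := fun n => 0 ^ n * c n) 0 ?_ using 1
          · simp
          · intro n hn
            simp [hn]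
        · rw [Function.update_of_ne hz0]
          have h1 : R < ‖z⁻¹‖ := by
            rw [norm_inv]
            rw [mem_ball_zero_iff] at hz
            have := (lt_inv_comm₀ (norm_pos_iff.2 hz0) (by positivity)).1 hz
            linarith [le_abs_self R]
          refine (hsum _ h1).congr_fun ?_
          intro n
          simp [mul_comm]
      exact this.analyticAt
    · have hη' : η⁻¹ ∈ exteriorDisk := by
        change 1 < ‖η⁻¹‖
        rw [norm_inv]
        exact (one_lt_inv₀ (norm_pos_iff.2 hne)).2 (by simpa using hη)
      have h1 : AnalyticAt ℂ (fun η => g η⁻¹) η := (hg _ hη').fun_comp (analyticAt_inv hne)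
      refine h1.congr ?_
      filter_upwards [isOpen_ne.mem_nhds hne] with z hz
      rw [Function.update_of_ne hz]
  · have : ζ⁻¹ ≠ 0 := inv_ne_zero (by rintro rfl; simp [exteriorDisk] at hζ; linarith)
    rw [Function.update_of_ne this, inv_inv]


lemma inv_mem_ball {ζ : ℂ} (hζ : ζ ∈ exteriorDisk) : ζ⁻¹ ∈ ball (0 : ℂ) 1 := by
  rw [mem_ball_zero_iff, norm_inv]
  exact inv_lt_one_of_one_lt₀ hζ

lemma ne_zero_of_mem_exteriorDisk {ζ : ℂ} (hζ : ζ ∈ exteriorDisk) : ζ ≠ 0 := by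
  rintro rfl
  simp [exteriorDisk] at hζ
  linarith

lemma inv_mem_exteriorDisk {η : ℂ} (hη : η ∈ ball (0 : ℂ) 1) (h0 : η ≠ 0) :
    η⁻¹ ∈ exteriorDisk := by
  change 1 < ‖η⁻¹‖
  rw [norm_inv]
  exact (one_lt_inv₀ (norm_pos_iff.2 h0)).2 (by simpa using hη)

lemma hasDerivAt_of_eq_comp_inv {g G : ℂ → ℂ} (hG : AnalyticOnNhd ℂ G (ball 0 1))
    (h : ∀ ζ ∈ exteriorDisk, g ζ = G ζ⁻¹) {ζ : ℂ} (hζ : ζ ∈ exteriorDisk) :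
    HasDerivAt g (-(ζ⁻¹ ^ 2 * deriv G ζ⁻¹)) ζ := by
  have h1 := (hG _ (inv_mem_ball hζ)).differentiableAt.hasDerivAt.comp ζ
    (hasDerivAt_inv (ne_zero_of_mem_exteriorDisk hζ))
  have h2 : g =ᶠ[𝓝 ζ] G ∘ fun z => z⁻¹ := by
    filter_upwards [isOpen_exteriorDisk.mem_nhds hζ] with z hz using h z hz
  refine (h1.congr_of_eventuallyEq h2).congr_deriv ?_
  rw [inv_pow]
  ring

/-! ### Estimates in the unit disk -/

/-- The Schwarz lemma for `(1 - H) / H`, where `H` has values in the half-plane `Re ≥ 1 / 2`. -/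
lemma norm_one_sub_le_of_half_le_re {H : ℂ → ℂ} (hH : AnalyticOnNhd ℂ H (ball 0 1))
    (H0 : H 0 = 1) (hre : ∀ η ∈ ball (0 : ℂ) 1, 1 / 2 ≤ (H η).re) {η : ℂ} (hη : η ∈ ball (0 : ℂ) 1) :
    ‖(1 - H η) / H η‖ ≤ ‖η‖ := by
  refine Complex.norm_le_norm_of_mapsTo_ball (f := fun η => (1 - H η) / H η) (R := 1)
    ?_ ?_ (by simp [H0]) (by simpa using hη)
  · intro z hz
    exact (((analyticAt_const.sub (hH z hz)).div (hH z hz)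
      (ne_zero_of_half_le_re (hre z hz))).differentiableAt).differentiableWithinAt
  · intro z hz
    rw [mem_closedBall_zero_iff, norm_div]
    refine div_le_one_of_le₀ ?_ (norm_nonneg _)
    -- After squaring, `|1 - H| ≤ |H|` becomes `2 Re H ≥ 1`.
    rw [← sq_le_sq₀ (norm_nonneg _) (norm_nonneg _), ← Complex.normSq_eq_norm_sq,
      ← Complex.normSq_eq_norm_sq, Complex.normSq_apply, Complex.normSq_apply]
    have := hre z hz
    simp only [Complex.sub_re, Complex.one_re, Complex.sub_im, Complex.one_im]
    nlinarith

lemma norm_one_sub_lt_of_half_le_re {H : ℂ → ℂ} (hH : AnalyticOnNhd ℂ H (ball 0 1))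
    (H0 : H 0 = 1) (hre : ∀ η ∈ ball (0 : ℂ) 1, 1 / 2 ≤ (H η).re) {η : ℂ} (hη : η ∈ ball (0 : ℂ) 1) :
    ‖1 - H η‖ < ‖H η‖ := by
  have h1 := norm_one_sub_le_of_half_le_re hH H0 hre hη
  have h2 := norm_pos_iff.2 (ne_zero_of_half_le_re (hre η hη))
  rw [mem_ball_zero_iff] at hη
  rw [norm_div, div_le_iff₀ h2] at h1
  nlinarith

/-- The exterior inequality multiplied by `|η|²`; the terms `-(η² y)` and `-(η² z)` come from the
chain rule for `ζ ↦ 1/ζ`. -/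
lemma norm_le_of_exterior_inequality {x y z η : ℂ} (h0 : η ≠ 0)
    (h : ‖x * (‖η⁻¹‖ : ℂ) ^ 2 - ((‖η⁻¹‖ : ℂ) ^ 2 - 1) *
      (η⁻¹ * -(η ^ 2 * y) + η⁻¹ * -(η ^ 2 * z))‖ ≤ 1) :
    ‖x + (1 - (‖η‖ : ℂ) ^ 2) * η * (y + z)‖ ≤ ‖η‖ ^ 2 := by
  have hn : (‖η‖ : ℂ) ≠ 0 := by simpa using h0
  have e : x + (1 - (‖η‖ : ℂ) ^ 2) * η * (y + z) = (‖η‖ : ℂ) ^ 2 *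
      (x * (‖η⁻¹‖ : ℂ) ^ 2 - ((‖η⁻¹‖ : ℂ) ^ 2 - 1) *
        (η⁻¹ * -(η ^ 2 * y) + η⁻¹ * -(η ^ 2 * z))) := by
    rw [norm_inv]
    push_cast
    field_simp
    ring
  rw [e, norm_mul]
  have : ‖(‖η‖ : ℂ) ^ 2‖ = ‖η‖ ^ 2 := by simp
  rw [this]
  exact mul_le_of_le_one_right (by positivity) h

/-- The function `b ζ + ⋯` has a pole at infinity: the logarithmic derivative of `u` at the origin
would be unbounded otherwise. -/
lemma apply_zero_ne_zero_of_disk_inequality {u H : ℂ → ℂ} (hu : AnalyticOnNhd ℂ u (ball 0 1))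
    (hH : AnalyticOnNhd ℂ H (ball 0 1)) (H0 : H 0 = 1)
    (hre : ∀ η ∈ ball (0 : ℂ) 1, 1 / 2 ≤ (H η).re)
    (hu0 : ∀ η ∈ ball (0 : ℂ) 1, η ≠ 0 → u η ≠ 0)
    (hineq : ∀ η ∈ ball (0 : ℂ) 1, η ≠ 0 →
      ‖(1 - H η) / H η + (1 - (‖η‖ : ℂ) ^ 2) * η * (deriv H η / H η + deriv u η / u η)‖ ≤ ‖η‖ ^ 2) :
    u 0 ≠ 0 := by
  have h00 : (0 : ℂ) ∈ ball (0 : ℂ) 1 := mem_ball_self one_pos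
  refine (hu 0 h00).ne_zero_of_meromorphicOrderAt_eq_zero ?_
  have hcont : ContinuousAt (fun η => ‖deriv H η / H η‖) 0 :=
    ((hH 0 h00).deriv.continuousAt.div (hH 0 h00).continuousAt (by simp [H0])).norm
  refine meromorphicOrderAt_eq_zero_of_logDeriv_bounded (C := 4 + (‖deriv H 0 / H 0‖ + 1))
    (hu 0 h00).meromorphicAt (fun htop => ?_) ?_
  · obtain ⟨z, hz, hz1, hz0⟩ := ((meromorphicOrderAt_eq_top_iff.1 htop).and
      ((eventually_nhdsWithin_of_eventually_nhds
        (isOpen_ball.eventually_mem h00)).and self_mem_nhdsWithin)).exists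
    exact hu0 z hz1 hz0 hz
  · filter_upwards [mem_nhdsWithin_of_mem_nhds (ball_mem_nhds (0 : ℂ) (half_pos one_pos)),
      mem_nhdsWithin_of_mem_nhds (hcont.eventually (gt_mem_nhds (lt_add_one _))),
      self_mem_nhdsWithin] with η h1 h2 h3
    have h1' : ‖η‖ < 1 / 2 := by simpa using h1
    have hη : η ∈ ball (0 : ℂ) 1 := ball_subset_ball (by norm_num) h1
    have hpos : 0 < ‖η‖ := norm_pos_iff.2 h3
    have hI := hineq η hη h3
    have hS := norm_one_sub_le_of_half_le_re hH H0 hre hη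
    rw [logDeriv_apply]
    set X := (1 - H η) / H η
    set Y := deriv H η / H η
    set Z := deriv u η / u η
    have e1 : ‖(1 - (‖η‖ : ℂ) ^ 2) * η * (Y + Z)‖ = (1 - ‖η‖ ^ 2) * ‖η‖ * ‖Y + Z‖ := by
      rw [norm_mul, norm_mul]
      congr 2
      rw [← abs_of_pos (show 0 < 1 - ‖η‖ ^ 2 by nlinarith), ← Real.norm_eq_abs,
        ← Complex.norm_real]
      push_cast
      rfl
    have e2 : (1 - ‖η‖ ^ 2) * ‖η‖ * ‖Y + Z‖ ≤ ‖η‖ ^ 2 + ‖η‖ := by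
      rw [← e1]
      have := norm_sub_le (X + (1 - (‖η‖ : ℂ) ^ 2) * η * (Y + Z)) X
      rw [add_sub_cancel_left] at this
      linarith
    -- The Schwarz bound `|X| ≤ |η|` allows division by `|η|`, which keeps the estimate bounded at
    -- the origin.
    have e3 : (1 - ‖η‖ ^ 2) * ‖Y + Z‖ ≤ ‖η‖ + 1 :=
      le_of_mul_le_mul_left (by linarith) hpos
    have e4 : ‖Y + Z‖ ≤ 4 := by
      have : 3 / 4 * ‖Y + Z‖ ≤ (1 - ‖η‖ ^ 2) * ‖Y + Z‖ := by
        gcongr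
        nlinarith
      linarith
    have e5 := norm_sub_le (Y + Z) Y
    rw [add_sub_cancel_left] at e5
    linarith

lemma tendsto_cobounded_mul_add_comp_inv {f G : ℂ → ℂ} {b : ℂ} (hb : b ≠ 0)
    (hG : ContinuousAt G 0) (hfG : ∀ ζ ∈ exteriorDisk, f ζ = b * ζ + G ζ⁻¹) :
    Tendsto f (cobounded ℂ) (cobounded ℂ) := by
  rw [← tendsto_norm_atTop_iff_cobounded]
  have h1 : Tendsto (fun ζ => ‖G ζ⁻¹‖) (cobounded ℂ) (𝓝 ‖G 0‖) :=
    (hG.tendsto.comp tendsto_inv₀_cobounded).norm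
  have h2 : Tendsto (fun ζ : ℂ => ‖b‖ * ‖ζ‖ + -‖G ζ⁻¹‖) (cobounded ℂ) atTop :=
    (tendsto_norm_cobounded_atTop.const_mul_atTop (norm_pos_iff.2 hb)).atTop_add h1.neg
  refine tendsto_atTop_mono' _ ?_ h2
  filter_upwards [tendsto_norm_cobounded_atTop.eventually_gt_atTop 1] with ζ hζ
  rw [hfG ζ hζ, ← norm_mul]
  have := norm_sub_le (b * ζ + G ζ⁻¹) (G ζ⁻¹)
  rw [add_sub_cancel_right] at this
  linarith

lemma exists_injOn_near_infinity {f G : ℂ → ℂ} {b : ℂ} (hb : b ≠ 0)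
    (hG : AnalyticAt ℂ G 0) (hfG : ∀ ζ ∈ exteriorDisk, f ζ = b * ζ + G ζ⁻¹) :
    ∃ M : ℝ, InjOn f {ζ | M < ‖ζ‖} := by
  obtain ⟨K, s, hs, hK⟩ := hG.hasStrictDerivAt.hasStrictFDerivAt.exists_lipschitzOnWith
  obtain ⟨ε, hε, hεs⟩ := Metric.mem_nhds_iff.1 hs
  -- Beyond `ε⁻¹` the inverses lie where `G` is `K`-Lipschitz; beyond `1` and `K / ‖b‖` the
  -- variation of `G ζ⁻¹` is strictly smaller than that of `b ζ`.
  refine ⟨max (max 1 ε⁻¹) (K / ‖b‖), fun x hx y hy hxy => ?_⟩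
  simp only [mem_ofPred_eq, max_lt_iff] at hx hy
  obtain ⟨⟨hx1, hx2⟩, hx3⟩ := hx
  obtain ⟨⟨hy1, hy2⟩, hy3⟩ := hy
  have hmem : ∀ z : ℂ, ε⁻¹ < ‖z‖ → z⁻¹ ∈ s := by
    intro z hz
    refine hεs ?_
    rw [mem_ball_zero_iff, norm_inv]
    exact inv_lt_of_inv_lt₀ hε hz
  have hL := hK.norm_sub_le (hmem x hx2) (hmem y hy2)
  rw [hfG x hx1, hfG y hy1] at hxy
  have e1 : G x⁻¹ - G y⁻¹ = -(b * (x - y)) := by linear_combination hxy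
  have hx0 := ne_zero_of_mem_exteriorDisk hx1
  have hy0 := ne_zero_of_mem_exteriorDisk hy1
  have e2 : x⁻¹ - y⁻¹ = -(x - y) * (x⁻¹ * y⁻¹) := by field_simp; ring
  rw [e1, e2, norm_neg, norm_mul, norm_mul, norm_neg, norm_mul, norm_inv, norm_inv] at hL
  have hbpos := norm_pos_iff.2 hb
  have h3 : K * (‖x‖⁻¹ * ‖y‖⁻¹) < ‖b‖ := by
    rw [div_lt_iff₀ hbpos] at hx3
    have hxp : 0 < ‖x‖ := by linarith
    have hy' : ‖y‖⁻¹ ≤ 1 := (inv_lt_one_of_one_lt₀ hy1).le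
    calc (K : ℝ) * (‖x‖⁻¹ * ‖y‖⁻¹) ≤ K * (‖x‖⁻¹ * 1) := by gcongr
      _ = K / ‖x‖ := by ring
      _ < ‖b‖ := by rw [div_lt_iff₀ hxp]; linarith
  by_contra hne
  have h4 : 0 < ‖x - y‖ := norm_pos_iff.2 (sub_ne_zero.2 hne)
  nlinarith

/-! ### The Beltrami estimate -/

/-- The Beltrami coefficient of the reflection across the circle of radius `ρ⁻¹`. -/
lemma norm_beltrami_lt {G H u : ℂ → ℂ} {b : ℂ} (hG : AnalyticOnNhd ℂ G (ball 0 1))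
    (hH : AnalyticOnNhd ℂ H (ball 0 1)) (H0 : H 0 = 1)
    (hre : ∀ η ∈ ball (0 : ℂ) 1, 1 / 2 ≤ (H η).re)
    (hu : ∀ η, u η = b - η ^ 2 * deriv G η) (hu0 : ∀ η ∈ ball (0 : ℂ) 1, u η ≠ 0)
    (hineq : ∀ η ∈ ball (0 : ℂ) 1, η ≠ 0 →
      ‖(1 - H η) / H η + (1 - (‖η‖ : ℂ) ^ 2) * η * (deriv H η / H η + deriv u η / u η)‖ ≤ ‖η‖ ^ 2)
    {ρ : ℝ} (hρ0 : 0 < ρ) (hρ1 : ρ < 1) {η : ℂ} (hη : ‖η‖ ≤ ρ) :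
    ‖(ρ : ℂ) ^ 2 * deriv (fun z => G z - dslope (fun z => u z * H z) 0 z) η
      + conj η * deriv (fun z => u z * H z) η‖ < ‖u η * H η‖ := by
  have h00 : (0 : ℂ) ∈ ball (0 : ℂ) 1 := mem_ball_self one_pos
  have hua : AnalyticOnNhd ℂ u (ball 0 1) := by
    intro z hz
    rw [show u = fun η => b - η ^ 2 * deriv G η from funext hu]
    have := (hG z hz).deriv
    fun_prop
  set B : ℂ → ℂ := fun z => u z * H z with hBdef
  have hB : AnalyticOnNhd ℂ B (ball 0 1) := fun z hz => (hua z hz).mul (hH z hz)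
  have hD : AnalyticOnNhd ℂ (dslope B 0) (ball 0 1) :=
    ((Complex.differentiableOn_dslope (ball_mem_nhds _ one_pos)).2
      hB.differentiableOn).analyticOnNhd isOpen_ball
  -- With `η = 1/w*`, `A η + w * B η` is `f(w*) + (w - w*) f'(w*) h(w*)`: the term `b/η` in `f(1/η)`
  -- cancels the pole of `B η / η`, so `A` is analytic at `0`.
  set A : ℂ → ℂ := fun z => G z - dslope B 0 z
  have hA : AnalyticOnNhd ℂ A (ball 0 1) := fun z hz => (hG z hz).sub (hD z hz)
  have hB0 : B 0 = b := by simp [hBdef, hu, H0]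
  -- This weight satisfies `ρ² - lam z = ‖z‖² (1 - lam z)`, which turns the estimate into a convex
  -- combination of the hypothesis and the Schwarz bound.
  let lam : ℂ → ℝ := fun z => (ρ ^ 2 - ‖z‖ ^ 2) / (1 - ‖z‖ ^ 2)
  have hηb : ∀ z : ℂ, ‖z‖ ≤ ρ → z ∈ ball (0 : ℂ) 1 := fun z hz => by
    rw [mem_ball_zero_iff]; linarith
  have hpunct : ∀ z : ℂ, ‖z‖ ≤ ρ → z ≠ 0 →
      ‖(ρ : ℂ) ^ 2 * deriv A z + conj z * deriv B z‖
        ≤ lam z * ‖B z‖ + (1 - lam z) * ‖u z * (1 - H z)‖ := by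
    intro z hz hz0
    have hzb := hηb z hz
    have hHz := ne_zero_of_half_le_re (hre z hzb)
    have huz := hu0 z hzb
    have hzpos := norm_pos_iff.2 hz0
    have hs : 0 < 1 - ‖z‖ ^ 2 := by nlinarith
    have hlam0 : 0 ≤ lam z := div_nonneg (by nlinarith) hs.le
    have hlam1 : 0 ≤ 1 - lam z := by
      rw [sub_nonneg, div_le_one hs]
      nlinarith
    have hB' : deriv B z = deriv u z * H z + u z * deriv H z :=
      ((hua z hzb).differentiableAt.hasDerivAt.mul (hH z hzb).differentiableAt.hasDerivAt).deriv
    have hDz : deriv (dslope B 0) z = (deriv B z - dslope B 0 z) / z := by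
      have h1 : HasDerivAt (fun z => z * dslope B 0 z)
          (1 * dslope B 0 z + z * deriv (dslope B 0) z) z :=
        (hasDerivAt_id z).mul (hD z hzb).differentiableAt.hasDerivAt
      have h2 : (fun z => z * dslope B 0 z) = fun z => B z - B 0 := by
        funext w
        simpa using sub_smul_dslope B 0 w
      rw [h2] at h1
      have h3 := h1.unique ((hB z hzb).differentiableAt.hasDerivAt.sub_const (B 0))
      rw [eq_div_iff hz0]
      linear_combination h3
    have hslope : dslope B 0 z = (B z - b) / z := by
      rw [dslope_of_ne _ hz0, slope_def_field, hB0, sub_zero]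
    have hA' : deriv A z = deriv G z - deriv (dslope B 0) z :=
      ((hG z hzb).differentiableAt.hasDerivAt.sub (hD z hzb).differentiableAt.hasDerivAt).deriv
    have hGz : z ^ 2 * deriv G z = b - u z := by rw [hu]; ring
    have hkey : z ^ 2 * ((ρ : ℂ) ^ 2 * deriv A z + conj z * deriv B z)
        = -((ρ : ℂ) ^ 2 * (u z * (1 - H z)) + ((ρ : ℂ) ^ 2 - (‖z‖ : ℂ) ^ 2) * z * deriv B z) := by
      have hc : z * conj z = (‖z‖ : ℂ) ^ 2 := by
        rw [Complex.mul_conj, Complex.normSq_eq_norm_sq]; push_cast; rfl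
      have h1 : z ^ 2 * deriv (dslope B 0) z = z * deriv B z - (B z - b) := by
        rw [hDz, hslope]
        field_simp
      have hBz : B z = u z * H z := rfl
      rw [hA']
      linear_combination (ρ : ℂ) ^ 2 * hGz - (ρ : ℂ) ^ 2 * h1 + z * deriv B z * hc
        + (ρ : ℂ) ^ 2 * hBz
    set W := u z * (1 - H z) + (1 - (‖z‖ : ℂ) ^ 2) * z * deriv B z with hW
    have hWle : ‖W‖ ≤ ‖z‖ ^ 2 * ‖B z‖ := by
      have h1 : W = B z * ((1 - H z) / H z + (1 - (‖z‖ : ℂ) ^ 2) * z *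
          (deriv H z / H z + deriv u z / u z)) := by
        rw [hW, hB']
        simp only [hBdef]
        field_simp
        ring
      rw [h1, norm_mul, mul_comm]
      gcongr
      exact hineq z hzb hz0
    have hsplit : (ρ : ℂ) ^ 2 * (u z * (1 - H z)) + ((ρ : ℂ) ^ 2 - (‖z‖ : ℂ) ^ 2) * z * deriv B z
        = (lam z : ℂ) * W + ((‖z‖ ^ 2 * (1 - lam z) : ℝ) : ℂ) * (u z * (1 - H z)) := by
      have hsC : (1 - (‖z‖ : ℂ) ^ 2) ≠ 0 := by exact_mod_cast hs.ne'
      have hl : (lam z : ℂ) = ((ρ : ℂ) ^ 2 - (‖z‖ : ℂ) ^ 2) / (1 - (‖z‖ : ℂ) ^ 2) := by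
        simp only [lam]; push_cast; rfl
      rw [hW]
      push_cast
      rw [hl]
      field_simp
      ring
    have hfin : ‖z‖ ^ 2 * ‖(ρ : ℂ) ^ 2 * deriv A z + conj z * deriv B z‖
        ≤ ‖z‖ ^ 2 * (lam z * ‖B z‖ + (1 - lam z) * ‖u z * (1 - H z)‖) := by
      rw [← norm_pow, ← norm_mul, hkey, norm_neg, hsplit]
      refine (norm_add_le _ _).trans ?_
      rw [norm_mul, norm_mul, Complex.norm_real, Complex.norm_real, Real.norm_eq_abs,
        Real.norm_eq_abs, abs_of_nonneg hlam0, abs_of_nonneg (by positivity), norm_pow]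
      nlinarith [mul_le_mul_of_nonneg_left hWle hlam0]
    exact le_of_mul_le_mul_left hfin (by positivity)
  have hall : ‖(ρ : ℂ) ^ 2 * deriv A η + conj η * deriv B η‖
        ≤ lam η * ‖B η‖ + (1 - lam η) * ‖u η * (1 - H η)‖ := by
    -- The punctured estimate was divided by `‖z‖²`; the origin follows by continuity.
    rcases eq_or_ne η 0 with rfl | hη0
    · have c1 := (hA 0 h00).deriv.continuousAt
      have c2 := (hB 0 h00).deriv.continuousAt
      have c3 := (hB 0 h00).continuousAt
      have c4 := (hua 0 h00).continuousAt
      have c5 := (hH 0 h00).continuousAt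
      have c6 : ContinuousAt lam 0 := by
        simp only [lam]
        refine ContinuousAt.div (by fun_prop) (by fun_prop) (by simp)
      have c7 : ContinuousAt (fun z : ℂ => conj z) 0 := Complex.continuous_conj.continuousAt
      have l1 : ContinuousAt (fun z => ‖(ρ : ℂ) ^ 2 * deriv A z + conj z * deriv B z‖) 0 :=
        ((continuousAt_const.mul c1).add (c7.mul c2)).norm
      have l2 : ContinuousAt (fun z => lam z * ‖B z‖ + (1 - lam z) * ‖u z * (1 - H z)‖) 0 :=
        (c6.mul c3.norm).add ((continuousAt_const.sub c6).mul
          (c4.mul (continuousAt_const.sub c5)).norm)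
      refine le_of_tendsto_of_tendsto (b := 𝓝[≠] (0 : ℂ))
        (l1.tendsto.mono_left nhdsWithin_le_nhds) (l2.tendsto.mono_left nhdsWithin_le_nhds) ?_
      filter_upwards [mem_nhdsWithin_of_mem_nhds (closedBall_mem_nhds (0 : ℂ) hρ0),
        self_mem_nhdsWithin] with z hz hz0
      exact hpunct z (by simpa using hz) hz0
    · exact hpunct η hη hη0
  have hb := hηb η hη
  have huη := norm_pos_iff.2 (hu0 η hb)
  have hlt : ‖u η * (1 - H η)‖ < ‖B η‖ := by
    rw [hBdef]
    simp only [norm_mul]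
    exact mul_lt_mul_of_pos_left (norm_one_sub_lt_of_half_le_re hH H0 hre hb) huη
  -- Strictness uses `ρ < 1`: the Schwarz term, which is strictly smaller, has positive weight.
  have hlam1 : 0 < 1 - lam η := by
    rw [sub_pos, div_lt_one (by nlinarith [norm_nonneg η])]
    nlinarith
  refine hall.trans_lt ?_
  nlinarith

/-! ### Conclusion -/

/-- The criterion for a function without finite poles, in terms of the expansions at infinity. -/
theorem injOn_of_disk_inequality {f G H u : ℂ → ℂ} {b : ℂ} (hG : AnalyticOnNhd ℂ G (ball 0 1))
    (hH : AnalyticOnNhd ℂ H (ball 0 1)) (H0 : H 0 = 1)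
    (hre : ∀ η ∈ ball (0 : ℂ) 1, 1 / 2 ≤ (H η).re)
    (hf : AnalyticOnNhd ℂ f exteriorDisk)
    (hfG : ∀ ζ ∈ exteriorDisk, f ζ = b * ζ + G ζ⁻¹)
    (hf' : ∀ ζ ∈ exteriorDisk, deriv f ζ = u ζ⁻¹)
    (hu : ∀ η, u η = b - η ^ 2 * deriv G η) (hu0 : ∀ η ∈ ball (0 : ℂ) 1, u η ≠ 0)
    (hineq : ∀ η ∈ ball (0 : ℂ) 1, η ≠ 0 →
      ‖(1 - H η) / H η + (1 - (‖η‖ : ℂ) ^ 2) * η * (deriv H η / H η + deriv u η / u η)‖ ≤ ‖η‖ ^ 2) :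
    InjOn f exteriorDisk := by
  have h00 : (0 : ℂ) ∈ ball (0 : ℂ) 1 := mem_ball_self one_pos
  have hb : b ≠ 0 := by simpa [hu] using hu0 0 h00
  have hua : AnalyticOnNhd ℂ u (ball 0 1) := by
    intro z hz
    rw [show u = fun η => b - η ^ 2 * deriv G η from funext hu]
    have := (hG z hz).deriv
    fun_prop
  set B : ℂ → ℂ := fun z => u z * H z with hBdef
  have hB : AnalyticOnNhd ℂ B (ball 0 1) := fun z hz => (hua z hz).mul (hH z hz)
  have hD : AnalyticOnNhd ℂ (dslope B 0) (ball 0 1) :=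
    ((Complex.differentiableOn_dslope (ball_mem_nhds _ one_pos)).2
      hB.differentiableOn).analyticOnNhd isOpen_ball
  have hB0 : B 0 = b := by simp [hBdef, hu, H0]
  obtain ⟨M, hM⟩ := exists_injOn_near_infinity hb (hG 0 h00) hfG
  have key : ∀ r : ℝ, 1 < r → InjOn f {w | r ≤ ‖w‖} := by
    intro r hr
    have hr0 : 0 < r := by linarith
    have hr1 : r⁻¹ < 1 := inv_lt_one_of_one_lt₀ hr
    have hball : ∀ η : ℂ, ‖η‖ ≤ r⁻¹ → η ∈ ball (0 : ℂ) 1 := fun η hη => by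
      rw [mem_ball_zero_iff]; linarith
    have hext : ∀ w : ℂ, r ≤ ‖w‖ → w ∈ exteriorDisk := fun w hw => hr.trans_le hw
    refine injOn_of_reflection (A := fun z => G z - dslope B 0 z) (B := B) (M := M) hr0
      (fun w hw => hf w (hext w hw)) (fun w hw => ?_)
      (fun η hη => (hG η (hball η hη)).sub (hD η (hball η hη)))
      (fun η hη => hB η (hball η hη)) (fun w hw => ?_) (fun η hη => ?_) (fun w hw => ?_)
      (tendsto_cobounded_mul_add_comp_inv hb (hG 0 h00).continuousAt hfG) hM
    · rw [hf' w (hext w hw)]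
      exact hu0 _ (inv_mem_ball (hext w hw))
    · have hw0 := ne_zero_of_mem_exteriorDisk (hext w hw.ge)
      rw [hfG w (hext w hw.ge), dslope_of_ne _ (inv_ne_zero hw0), slope_def_field, hB0]
      field_simp
      ring
    · have := norm_beltrami_lt hG hH H0 hre hu hu0 hineq (inv_pos.2 hr0) hr1 hη
      push_cast at this
      rwa [inv_pow] at this
    · have hwb := inv_mem_ball (hext w hw.ge)
      rw [hf' w (hext w hw.ge)]
      rw [hBdef]
      simp only
      rw [show u w⁻¹ - u w⁻¹ * H w⁻¹ = u w⁻¹ * (1 - H w⁻¹) by ring, norm_mul, norm_mul]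
      exact mul_lt_mul_of_pos_left (norm_one_sub_lt_of_half_le_re hH H0 hre hwb)
        (norm_pos_iff.2 (hu0 _ hwb))
  -- Any two points of the exterior lie outside a common circle of radius greater than `1`.
  intro x (hx : 1 < ‖x‖) y (hy : 1 < ‖y‖) hxy
  have hx' : min ‖x‖ ‖y‖ ≤ ‖x‖ := min_le_left _ _
  have hy' : min ‖x‖ ‖y‖ ≤ ‖y‖ := min_le_right _ _
  exact key _ (lt_min hx hy) hx' hy' hxy

theorem corollaryc1 (f h : ℂ → ℂ)
    (hf : InClassSigma f) (hloc : LocallyUnivalentOn f exteriorDisk)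
    (hh : AnalyticOnNhd ℂ h exteriorDisk)
    (hre : ∀ ζ ∈ exteriorDisk, 1 / 2 ≤ (h ζ).re)
    (hexp : HasUnitExpansion h)
    (hineq : ∀ ζ ∈ exteriorDisk, ¬ IsPoleOf f ζ →
      ‖(1 - h ζ) / h ζ * (‖ζ‖ : ℂ) ^ 2
        - ((‖ζ‖ : ℂ) ^ 2 - 1) *
          (ζ * deriv h ζ / h ζ + ζ * deriv (deriv f) ζ / deriv f ζ)‖ ≤ 1) :
    UnivalentOn f exteriorDisk := by
  have hfan : AnalyticOnNhd ℂ f exteriorDisk := fun p hp =>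
    (analyticAt_and_deriv_ne_zero hf.meromorphic hloc hh hre hineq hp).1
  have hf'0 : ∀ p ∈ exteriorDisk, deriv f p ≠ 0 := fun p hp =>
    (analyticAt_and_deriv_ne_zero hf.meromorphic hloc hh hre hineq hp).2
  obtain ⟨b, c, R, hsum⟩ := hf.expansion
  obtain ⟨G, hG, -, hfG'⟩ := exists_analytic_at_infinity (g := fun ζ => f ζ - b * ζ)
    (fun z hz => (hfan z hz).sub (analyticAt_const.mul analyticAt_id)) hsum
  have hfG : ∀ ζ ∈ exteriorDisk, f ζ = b * ζ + G ζ⁻¹ := fun ζ hζ => by rw [← hfG' ζ hζ]; ring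
  obtain ⟨d, hd0, -, hdsum⟩ := hexp
  obtain ⟨H, hH, H0, hhH⟩ := exists_analytic_at_infinity (R := 1) hh hdsum
  rw [hd0] at H0
  have hreH : ∀ η ∈ ball (0 : ℂ) 1, 1 / 2 ≤ (H η).re := by
    intro η hη
    rcases eq_or_ne η 0 with rfl | h0
    · rw [H0]; norm_num
    · have h1 := inv_mem_exteriorDisk hη h0
      have := hre _ h1
      rwa [hhH _ h1, inv_inv] at this
  let u : ℂ → ℂ := fun η => b - η ^ 2 * deriv G η
  have hua : AnalyticOnNhd ℂ u (ball 0 1) := by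
    intro z hz
    have := (hG z hz).deriv
    fun_prop
  have hf' : ∀ ζ ∈ exteriorDisk, deriv f ζ = u ζ⁻¹ := by
    intro ζ hζ
    have h1 := hasDerivAt_of_eq_comp_inv hG hfG' hζ
    have h2 := (hfan ζ hζ).differentiableAt.hasDerivAt.sub ((hasDerivAt_id ζ).const_mul b)
    have h3 := h2.unique h1
    simp only [u]
    linear_combination h3
  have hdisk : ∀ η ∈ ball (0 : ℂ) 1, η ≠ 0 →
      ‖(1 - H η) / H η + (1 - (‖η‖ : ℂ) ^ 2) * η * (deriv H η / H η + deriv u η / u η)‖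
        ≤ ‖η‖ ^ 2 := by
    intro η hη h0
    have h1 := inv_mem_exteriorDisk hη h0
    have h2 := hineq _ h1 (hfan _ h1).not_isPoleOf
    rw [(hasDerivAt_of_eq_comp_inv hua hf' h1).deriv, (hasDerivAt_of_eq_comp_inv hH hhH h1).deriv,
      hf' _ h1, hhH _ h1, inv_inv] at h2
    refine norm_le_of_exterior_inequality h0 (le_trans (le_of_eq ?_) h2)
    congr 3
    ring
  have hu0' : ∀ η ∈ ball (0 : ℂ) 1, η ≠ 0 → u η ≠ 0 := by
    intro η hη h0
    have h1 := inv_mem_exteriorDisk hη h0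
    have := hf'0 _ h1
    rwa [hf' _ h1, inv_inv] at this
  have hu0 : ∀ η ∈ ball (0 : ℂ) 1, u η ≠ 0 := by
    intro η hη
    rcases eq_or_ne η 0 with rfl | h0
    · exact apply_zero_ne_zero_of_disk_inequality hua hH H0 hreH hu0' hdisk
    · exact hu0' η hη h0
  have hinj := injOn_of_disk_inequality hG hH H0 hreH hfan hfG hf' (fun _ => rfl) hu0 hdisk
  intro x hx y hy hxy
  simp only [sphereValue, (hfan x hx).not_isPoleOf, (hfan y hy).not_isPoleOf, if_false,
    OnePoint.coe_eq_coe] at hxy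
  exact hinj hx hy hxy
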